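/- Let $\mathscr X\subseteq\mathbb R^n$ be convex with nonempty interior and let $I\subseteq[0,\infty)$ be an interval containing $0$ (for example $[0,\infty)$ or $[0,T]$). Derivatives at boundary points of $\mathscr X$ and of $I$ are taken within $\mathscr X$ and $I$. Consider the system $d\mathbf x=\mathbf F_{\mathbf w}(\mathbf x,t)\,dt+\sigma(\mathbf x,t)\,d\mathscr W(t)$ with closed-loop field $\mathbf F_{\mathbf w}=f+g\,\mathbf u_{cl}+\psi\,\mathbf w$, fault profile $\mathbf w=\mathbf w(t)$, and $\Sigma=\sigma\sigma^\top$. Let $\mathbf F_{\mathbf w_0}=f+g\,\mathbf u_{cl}$ be the nominal field ($\mathbf w_0=0$), and suppose that $\mathbf F_{\mathbf w_0}$ is continuous on $\mathscr X\times I$ and differentiable in $\mathbf x$, with $\partial\mathbf F_{\mathbf w_0}/\partial\mathbf x$ continuous on $\mathscr X\times I$. For each $t\in I$ let $\Sigma(\cdot,t)$ be $C^2$ and $\mathbf F_{\mathbf w}(\cdot,t)$ differentiable on $\mathscr X$. Let $\rho$ be a strictly positive classical solution on $\mathscr X\times I$ (with $\rho(\cdot,t)$ of class $C^2$ for each $t$,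 and differentiable in $t$) of the Fokker--Planck equation $\partial_t\rho=-\nabla\cdot(\rho\,\mathbf F_{\mathbf w})+\tfrac12\nabla\cdot\nabla\cdot(\rho\,\Sigma)$. Set $$\mathbf d^{\mathbf w}=\psi\mathbf w-\tfrac12\nabla\cdot\Sigma-\tfrac12\Sigma\nabla\log\rho,\qquad \mathbf v_{\mathbf w}=\mathbf F_{\mathbf w_0}+\mathbf d^{\mathbf w}=\mathbf F_{\mathbf w}-\tfrac12\bigl[\nabla\cdot\Sigma+\Sigma\nabla\log\rho\bigr].$$ Suppose that $\dot{\mathbf x}=\mathbf F_{\mathbf w_0}(\mathbf x,t)$ and the probability-flow ODE $\dot{\mathbf x}=\mathbf v_{\mathbf w}(\mathbf x,t)$ generate measurable two-time flow maps $\Phi^{\mathbf F_{\mathbf w_0}}_{s,t},\Phi^{\mathbf v_{\mathbf w}}_{s,t}:\mathscr X\to\mathscr X$, $s\le t$ in $I$. Suppose that there are $\alpha\in\mathbb R$, $\underline m,\overline m>0$ and a matrix-valued metric $\mathbf M=\Theta^\top\Theta$, with $\Theta$ continuously differentiable on $\mathscr X\times I$, such that for all $(\mathbf x,t)\in\mathscr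 X\times I$ $$\underline m\mathbf I\preceq\mathbf M(\mathbf x,t)\preceq\overline m\mathbf I,\qquad \dot{\mathbf M}+\mathbf M\frac{\partial\mathbf F_{\mathbf w_0}}{\partial\mathbf x}+\Bigl(\mathbf M\frac{\partial\mathbf F_{\mathbf w_0}}{\partial\mathbf x}\Bigr)^{\!\top}\preceq2\alpha\mathbf M,$$ where $\dot{\mathbf M}=\partial_t\mathbf M+\sum_k(\mathbf F_{\mathbf w_0})_k\,\partial_{x_k}\mathbf M$ is the derivative along the nominal dynamics, and suppose that $\|\mathbf d^{\mathbf w}(\mathbf x,t)\|\le\overline d$ for all $(\mathbf x,t)\in\mathscr X\times I$. Let $\mu_0,\nu_0$ be Borel probability measures on $\mathscr X$ with finite second moments, and for $t\in I$ put $\mu_t=(\Phi^{\mathbf F_{\mathbf w_0}}_{0,t})_\#\mu_0$ and $\nu_t=(\Phi^{\mathbf v_{\mathbf w}}_{0,t})_\#\nu_0$. Then for every $t\in I$ the measures $\mu_t,\nu_t$ are probability measures with finite second moments, and $$\mathbb W_2(\mu_t,\nu_t)\le\kappa\,e^{\alpha t}\,\mathbb W_2(\mu_0,\nu_0)+\kappa\,\overline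 d\int_0^te^{\alpha(t-r)}\,dr,\qquad\kappa=\sqrt{\overline m/\underline m}.$$ -/

import Mathlib

open MeasureTheory Set
open scoped ENNReal Matrix

noncomputable section

/-- `ℝⁿ` with the Euclidean norm. -/
abbrev Euc (n : ℕ) : Type := EuclideanSpace ℝ (Fin n)

/-! ### Wasserstein distance and probability measures with finite second moment -/

/-- `π` is a coupling of `μ` and `ν`: its marginals are `μ` and `ν`. -/
def IsCoupling {S : Type*} [MeasurableSpace S] (μ ν : Measure S) (π : Measure (S × S)) : Prop :=
  π.map Prod.fst = μ ∧ π.map Prod.snd = ν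

/-- The 2-Wasserstein distance, with values in `[0, ∞]`. -/
def W2 {S : Type*} [PseudoEMetricSpace S] [MeasurableSpace S] (μ ν : Measure S) : ℝ≥0∞ :=
  (⨅ (π : Measure (S × S)) (_ : IsCoupling μ ν π), ∫⁻ z, edist z.1 z.2 ^ 2 ∂π) ^ (1 / 2 : ℝ)

/-- Borel probability measures on `X ⊆ ℝⁿ` with finite second moment. -/
def IsP2 {n : ℕ} {X : Set (Euc n)} (μ : Measure X) : Prop :=
  IsProbabilityMeasure μ ∧ ∫⁻ x, ‖(x : Euc n)‖ₑ ^ 2 ∂μ < ∞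

/-! ### Flows and Perron-Frobenius operators -/

/-- `Φ s t : X → X`, for `s ≤ t` in the time interval `I`, is the two-time flow map of
`ẋ = v(x, t)` on the state space `X`. -/
structure IsFlow {n : ℕ} (X : Set (Euc n)) (I : Set ℝ) (v : Euc n → ℝ → Euc n)
    (Φ : ℝ → ℝ → X → X) : Prop where
  init : ∀ s ∈ I, ∀ x : X, Φ s s x = x
  ode : ∀ s ∈ I, ∀ t ∈ I, s ≤ t → ∀ x : X,
    HasDerivWithinAt (fun r => (Φ s r x : Euc n)) (v (Φ s t x) t) (I ∩ Ici s) t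
  comp : ∀ r ∈ I, ∀ s ∈ I, ∀ t ∈ I, r ≤ s → s ≤ t → ∀ x : X, Φ s t (Φ r s x) = Φ r t x
  meas : ∀ s ∈ I, ∀ t ∈ I, s ≤ t → Measurable (Φ s t)

/-- The Perron-Frobenius operator on measures: pushforward along the flow map. -/
def pfOperator {n : ℕ} {X : Set (Euc n)} (Φ : ℝ → ℝ → X → X) (s t : ℝ) (μ : Measure X) :
    Measure X :=
  μ.map (Φ s t)

/-! ### The control-affine system, its Fokker-Planck equation and its probability flow -/

/-- The coefficient functions of the control-affine system with faults
`dx = (f(x,t) + g(x,t) u + ψ(x,t) w) dt + σ(x,t) dW`, with nominal feedback `u = ucl(x,t)`. -/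
structure FaultSystem (n m p q : ℕ) where
  f : Euc n → ℝ → Euc n
  g : Euc n → ℝ → Matrix (Fin n) (Fin m) ℝ
  ψ : Euc n → ℝ → Matrix (Fin n) (Fin p) ℝ
  ucl : Euc n → ℝ → Euc m
  σ : Euc n → ℝ → Matrix (Fin n) (Fin q) ℝ

/-- The partial derivative `∂h/∂xᵢ` at `x`, taken within `X`. -/
def pderiv {n : ℕ} (X : Set (Euc n)) (i : Fin n) (h : Euc n → ℝ) (x : Euc n) : ℝ :=
  fderivWithin ℝ h X x (EuclideanSpace.single i 1)

namespace FaultSystem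

variable {n m p q : ℕ}

/-- The closed-loop vector field `F_w = f + g ucl + ψ w`. -/
def closedLoop (S : FaultSystem n m p q) (w : ℝ → Euc p) (x : Euc n) (t : ℝ) : Euc n :=
  S.f x t + WithLp.toLp 2 (S.g x t *ᵥ S.ucl x t) + WithLp.toLp 2 (S.ψ x t *ᵥ w t)

/-- The nominal (fault-free) closed-loop vector field `F_{w₀}`, `w₀ = 0`. -/
def nominal (S : FaultSystem n m p q) : Euc n → ℝ → Euc n :=
  S.closedLoop (fun _ => 0)

/-- The diffusion matrix `Σ = σ σᵀ`. -/
def diffusion (S : FaultSystem n m p q) (x : Euc n) (t : ℝ) : Matrix (Fin n) (Fin n) ℝ :=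
  S.σ x t * (S.σ x t)ᵀ

/-- The row-wise divergence `(∇ₓ·Σ)ᵢ = ∑ⱼ ∂Σᵢⱼ/∂xⱼ`. -/
def divDiffusion (S : FaultSystem n m p q) (X : Set (Euc n)) (x : Euc n) (t : ℝ) : Euc n :=
  WithLp.toLp 2 fun i => ∑ j, pderiv X j (fun y => S.diffusion y t i j) x

/-- The score `∇ₓ log ρ`. -/
def score (X : Set (Euc n)) (ρ : Euc n → ℝ → ℝ) (x : Euc n) (t : ℝ) : Euc n :=
  WithLp.toLp 2 fun i => pderiv X i (fun y => Real.log (ρ y t)) x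

/-- `ρ` is a strictly positive classical solution on `X × I` of the Fokker-Planck equation
`∂ρ/∂t = -∇·(ρ F_w) + ½ ∇·∇·(ρ Σ)`. -/
structure IsPosFokkerPlanck (S : FaultSystem n m p q) (X : Set (Euc n)) (I : Set ℝ)
    (w : ℝ → Euc p) (ρ : Euc n → ℝ → ℝ) : Prop where
  pos : ∀ x ∈ X, ∀ t ∈ I, 0 < ρ x t
  smooth : ∀ t ∈ I, ContDiffOn ℝ 2 (fun x => ρ x t) X
  smooth_diffusion : ∀ t ∈ I, ∀ i j, ContDiffOn ℝ 2 (fun x => S.diffusion x t i j) X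
  diff_drift : ∀ t ∈ I, DifferentiableOn ℝ (fun x => S.closedLoop w x t) X
  eqn : ∀ x ∈ X, ∀ t ∈ I, HasDerivWithinAt (fun s => ρ x s)
    (-(∑ i, pderiv X i (fun y => ρ y t * S.closedLoop w y t i) x)
      + 1 / 2 * ∑ i, ∑ j,
          pderiv X i (fun z => pderiv X j (fun y => ρ y t * S.diffusion y t i j) z) x) I t

/-- The probability-flow field `v_w = F_w - ½ [∇ₓ·Σ + Σ ∇ₓ log ρ]`. -/
def probFlow (S : FaultSystem n m p q) (X : Set (Euc n)) (w : ℝ → Euc p) (ρ : Euc n → ℝ → ℝ)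
    (x : Euc n) (t : ℝ) : Euc n :=
  S.closedLoop w x t - (1 / 2 : ℝ) •
    (S.divDiffusion X x t + WithLp.toLp 2 (S.diffusion x t *ᵥ score X ρ x t))

/-- The perturbation `d^w = ψ w - ½ ∇ₓ·Σ - ½ Σ ∇ₓ log ρ`. -/
def perturbation (S : FaultSystem n m p q) (X : Set (Euc n)) (w : ℝ → Euc p)
    (ρ : Euc n → ℝ → ℝ) (x : Euc n) (t : ℝ) : Euc n :=
  WithLp.toLp 2 (S.ψ x t *ᵥ w t) - (1 / 2 : ℝ) • S.divDiffusion X x t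
    - (1 / 2 : ℝ) • WithLp.toLp 2 (S.diffusion x t *ᵥ score X ρ x t)

/-- The probability flow is the perturbed nominal dynamics, `v_w = F_{w₀} + d^w`. -/
theorem probFlow_eq (S : FaultSystem n m p q) (X : Set (Euc n)) (w : ℝ → Euc p)
    (ρ : Euc n → ℝ → ℝ) (x : Euc n) (t : ℝ) :
    S.probFlow X w ρ x t = S.nominal x t + S.perturbation X w ρ x t := by
  have h : (WithLp.toLp 2 (S.ψ x t *ᵥ ((0 : Euc p) : Fin p → ℝ)) : Euc n) = 0 := by
    ext i; simp
  simp only [probFlow, nominal, perturbation, closedLoop, h, smul_add]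
  abel

end FaultSystem

/-! ### Contraction metrics -/

/-- The Jacobian matrix `∂F/∂x` at `(x, t)`, taken within `X`. -/
def jacobian {n : ℕ} (X : Set (Euc n)) (F : Euc n → ℝ → Euc n) (x : Euc n) (t : ℝ) :
    Matrix (Fin n) (Fin n) ℝ :=
  Matrix.of fun i j => fderivWithin ℝ (fun y => F y t) X x (EuclideanSpace.single j 1) i

/-- `Ṁ(x, t) = ∂M/∂t + ∑ₖ Fₖ ∂M/∂xₖ`, the derivative of `M` along `ẋ = F(x, t)`. -/
def metricDot {n : ℕ} (X : Set (Euc n)) (I : Set ℝ) (F : Euc n → ℝ → Euc n)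
    (M : Euc n → ℝ → Matrix (Fin n) (Fin n) ℝ) (x : Euc n) (t : ℝ) :
    Matrix (Fin n) (Fin n) ℝ :=
  Matrix.of fun i j => derivWithin (fun s => M x s i j) I t
    + ∑ k, F x t k * pderiv X k (fun y => M y t i j) x

/-- The symmetric part `½ (A + Aᵀ)`. -/
def symPart {n : ℕ} (A : Matrix (Fin n) (Fin n) ℝ) : Matrix (Fin n) (Fin n) ℝ :=
  (1 / 2 : ℝ) • (A + Aᵀ)

/-- The Loewner order `A ⪯ B`. -/
def LoewnerLE {n : ℕ} (A B : Matrix (Fin n) (Fin n) ℝ) : Prop :=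
  (B - A).PosSemidef

/-- `M = Θᵀ Θ`, with `Θ` continuously differentiable, is a metric satisfying
`mlo I ⪯ M ⪯ mhi I` and the deterministic contraction condition
`Ṁ + 2 sym(M ∂F/∂x) ⪯ 2 α M` on `X × I`. -/
structure IsContractionMetric {n : ℕ} (X : Set (Euc n)) (I : Set ℝ) (F : Euc n → ℝ → Euc n)
    (M Θ : Euc n → ℝ → Matrix (Fin n) (Fin n) ℝ) (α mlo mhi : ℝ) : Prop where
  factor : ∀ x ∈ X, ∀ t ∈ I, M x t = (Θ x t)ᵀ * Θ x t
  smooth : ∀ i j, ContDiffOn ℝ 1 (fun z : Euc n × ℝ => Θ z.1 z.2 i j) (X ×ˢ I)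
  lower : ∀ x ∈ X, ∀ t ∈ I, LoewnerLE (mlo • 1) (M x t)
  upper : ∀ x ∈ X, ∀ t ∈ I, LoewnerLE (M x t) (mhi • 1)
  contraction : ∀ x ∈ X, ∀ t ∈ I,
    LoewnerLE (metricDot X I F M x t + (2 : ℝ) • symPart (M x t * jacobian X F x t))
      ((2 * α) • M x t)

end

section

open Filter Topology

/-! The proof first compares trajectories, then couples. For starting points x and y, insert the
nominal trajectory from y: the distance between the nominal endpoint of x and the probability-flow
endpoint of y is at most a contraction term plus a perturbation term. Pushing any coupling of the
initial laws through the pair of flows, applying Minkowski in L², and taking the infimum over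
couplings gives the claim (`W2_map_le`).

Contraction term (`norm_flow_sub_le`): no differentiability of the flow in its initial point is
needed. For two nearby nominal trajectories with difference e, the form V = eᵀMe, with M taken along
one of them, satisfies V' ≤ (2α + ε)V while e is small, because linearizing the field costs only a
small multiple of |e|. This gives a local Lipschitz constant κ exp((α + ε)(t - s)) at each point;
convexity of X lets it be integrated along a segment, and ε tends to 0. As κ enters once per pair of
times, it does not compound.

Perturbation term (`norm_perturbed_sub_le`): follow the perturbed flow up to time s and the nominal
flow from s to t. As s runs from 0 to t, the endpoint moves from the nominal to the perturbed one,
at rate at most κ exp(α(t - s)) times the bound on the perturbation. Integrating the rate replaces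
Alekseev's formula. -/

/-- A mean value inequality from upper bounds on right difference quotients. -/
theorem norm_sub_le_of_right_quotient_le {E : Type*} [NormedAddCommGroup E] {g : ℝ → E}
    {B B' : ℝ → ℝ} {a b : ℝ} (hab : a ≤ b) (hg : ContinuousOn g (Icc a b))
    (hB : ContinuousOn B (Icc a b))
    (hB' : ∀ x ∈ Ico a b, HasDerivWithinAt B (B' x) (Ici x) x)
    (hq : ∀ x ∈ Ico a b, ∀ r, B' x < r → ∃ᶠ z in 𝓝[>] x, ‖g z - g x‖ ≤ r * (z - x)) :
    ‖g b - g a‖ ≤ B b - B a := by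
  -- The fencing lemma wants a strict inequality of slopes at contact; the extra slope η provides
  -- it.
  have key : ∀ η : ℝ, 0 < η → ‖g b - g a‖ ≤ B b - B a + η * (b - a) := by
    intro η hη
    refine image_le_of_liminf_slope_right_lt_deriv_boundary' (f := fun x => ‖g x - g a‖)
      (f' := B') (B := fun x => B x - B a + η * (x - a)) (B' := fun x => B' x + η)
      (by fun_prop) ?_ (by simp) (by fun_prop) ?_ ?_ (right_mem_Icc.2 hab)
    · intro x hx r hr
      obtain ⟨r', h1, h2⟩ := exists_between hr
      refine ((hq x hx r' h1).and_eventually self_mem_nhdsWithin).mono ?_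
      rintro z ⟨hz, hxz⟩
      have hxz' : 0 < z - x := sub_pos.2 hxz
      rw [slope_def_field, div_lt_iff₀ hxz']
      have h3 : ‖g z - g a‖ ≤ ‖g z - g x‖ + ‖g x - g a‖ := norm_sub_le_norm_sub_add_norm_sub ..
      nlinarith
    · intro x hx
      have h1 := ((hB' x hx).sub_const (B a)).add
        (((hasDerivWithinAt_id x (Ici x)).sub_const a).const_mul η)
      simpa using! h1
    · intro x _ _
      linarith
  refine le_of_forall_pos_le_add fun ε hε => ?_
  -- The added 1 keeps the denominator positive when a = b.
  have h := key (ε / (b - a + 1)) (by have := sub_nonneg.2 hab; positivity)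
  have h2 : ε / (b - a + 1) * (b - a) ≤ ε := by
    have := sub_nonneg.2 hab
    rw [div_mul_eq_mul_div, div_le_iff₀ (by positivity)]
    nlinarith
  linarith

/-! ### Derivatives and linearization along curves -/

theorem Euc.sum_smul_single {n : ℕ} (v : Euc n) :
    ∑ k, v k • (EuclideanSpace.single k 1 : Euc n) = v := by
  ext i
  simp [Pi.single_apply]

theorem Euc.dotProduct_self {n : ℕ} (v : Euc n) :
    (v : Fin n → ℝ) ⬝ᵥ (v : Fin n → ℝ) = ‖v‖ ^ 2 := by
  rw [EuclideanSpace.real_norm_sq_eq]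
  simp [dotProduct, sq]

/-- The chain rule for a matrix entry along a curve, with all derivatives taken within
`X × I`. -/
theorem hasDerivWithinAt_metric_along {n : ℕ} {X : Set (Euc n)} {I J : Set ℝ}
    {F : Euc n → ℝ → Euc n} {M : Euc n → ℝ → Matrix (Fin n) (Fin n) ℝ} {c : ℝ → Euc n} {r : ℝ}
    (hX : UniqueDiffWithinAt ℝ X (c r)) (hI : UniqueDiffWithinAt ℝ I r)
    (hcX : ∀ τ ∈ J, c τ ∈ X) (hJI : J ⊆ I) (hr : r ∈ J)
    (hc : HasDerivWithinAt c (F (c r) r) J r) (i j : Fin n)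
    (hM : DifferentiableWithinAt ℝ (fun z : Euc n × ℝ => M z.1 z.2 i j) (X ×ˢ I) (c r, r)) :
    HasDerivWithinAt (fun τ => M (c τ) τ i j) (metricDot X I F M (c r) r i j) J r := by
  set D := fderivWithin ℝ (fun z : Euc n × ℝ => M z.1 z.2 i j) (X ×ˢ I) (c r, r) with hD
  have hMD : HasFDerivWithinAt (fun z : Euc n × ℝ => M z.1 z.2 i j) D (X ×ˢ I) (c r, r) :=
    hM.hasFDerivWithinAt
  have htime : derivWithin (fun s => M (c r) s i j) I r = D (0, 1) := by
    refine HasDerivWithinAt.derivWithin ?_ hI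
    exact HasFDerivWithinAt.comp_hasDerivWithinAt (f := fun s : ℝ => (c r, s)) r hMD
      ((hasDerivWithinAt_const r I (c r)).prodMk (hasDerivWithinAt_id r I))
      (fun s hs => ⟨hcX r hr, hs⟩)
  have hspace : ∀ k, pderiv X k (fun y => M y r i j) (c r)
      = D (EuclideanSpace.single k 1, 0) := by
    intro k
    have h : HasFDerivWithinAt (fun y => M y r i j)
        (D.comp ((ContinuousLinearMap.id ℝ (Euc n)).prod 0)) X (c r) :=
      HasFDerivWithinAt.comp (f := fun y : Euc n => (y, r)) (c r) hMD
        ((hasFDerivWithinAt_id (c r) X).prodMk (hasFDerivWithinAt_const r (c r) X))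
        (fun y hy => ⟨hy, hJI hr⟩)
    rw [pderiv, h.fderivWithin hX]
    simp
  have hcomp : HasDerivWithinAt (fun τ => M (c τ) τ i j) (D (F (c r) r, 1)) J r :=
    HasFDerivWithinAt.comp_hasDerivWithinAt (f := fun τ => (c τ, τ)) r hMD
      (hc.prodMk (hasDerivWithinAt_id r J)) (fun τ hτ => ⟨hcX τ hτ, hJI hτ⟩)
  convert hcomp using 1
  -- Splitting the velocity (F, 1) into time and coordinate directions turns the joint derivative
  -- into the sum defining `metricDot`.
  have hsplit : ((F (c r) r, 1) : Euc n × ℝ)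
      = (0, 1) + ∑ k, F (c r) r k • ((EuclideanSpace.single k 1, 0) : Euc n × ℝ) := by
    have h2 : ∑ k, F (c r) r k • ((EuclideanSpace.single k 1, 0) : Euc n × ℝ)
        = (F (c r) r, 0) := by
      refine Prod.ext ?_ ?_
      · rw [Prod.fst_sum]
        exact Euc.sum_smul_single _
      · simp [Prod.snd_sum]
    rw [h2]
    simp
  rw [hsplit, map_add, map_sum]
  simp only [metricDot, Matrix.of_apply, htime, hspace, map_smul, smul_eq_mul]

theorem fderivWithin_apply_eq_jacobian_mulVec {n : ℕ} (X : Set (Euc n)) (F : Euc n → ℝ → Euc n)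
    (x : Euc n) (t : ℝ) (v : Euc n) :
    fderivWithin ℝ (fun y => F y t) X x v = WithLp.toLp 2 (jacobian X F x t *ᵥ v) := by
  conv_lhs => rw [← Euc.sum_smul_single v]
  ext i
  simp [jacobian, Matrix.mulVec, dotProduct, mul_comm]

/-- In finite dimension, operator-norm continuity can be tested on each fixed vector. -/
theorem continuousOn_fderivWithin_of_jacobian {n : ℕ} {X : Set (Euc n)} {I : Set ℝ}
    {F : Euc n → ℝ → Euc n}
    (hJ : ∀ i j, ContinuousOn (fun z : Euc n × ℝ => jacobian X F z.1 z.2 i j) (X ×ˢ I)) :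
    ContinuousOn (fun z : Euc n × ℝ => fderivWithin ℝ (fun y => F y z.2) X z.1) (X ×ˢ I) := by
  rw [continuousOn_clm_apply]
  intro v
  simp only [fderivWithin_apply_eq_jacobian_mulVec]
  refine (PiLp.continuous_toLp 2 _).comp_continuousOn (continuousOn_pi.2 fun i => ?_)
  simp only [Matrix.mulVec, dotProduct]
  exact continuousOn_finsetSum _ fun j _ => (hJ i j).mul continuousOn_const

/-- First-order expansion of a field along a continuous curve, uniform over a compact time
interval. -/
theorem exists_uniform_linearization {n : ℕ} {X : Set (Euc n)} (hX : Convex ℝ X) {s t : ℝ}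
    {F : Euc n → ℝ → Euc n} (hF : ∀ r ∈ Icc s t, DifferentiableOn ℝ (fun y => F y r) X)
    (hJ : ContinuousOn (fun z : Euc n × ℝ => fderivWithin ℝ (fun y => F y z.2) X z.1)
      (X ×ˢ Icc s t))
    {x : ℝ → Euc n} (hx : ContinuousOn x (Icc s t)) (hxX : ∀ r ∈ Icc s t, x r ∈ X)
    {η : ℝ} (hη : 0 < η) :
    ∃ δ > 0, ∀ r ∈ Icc s t, ∀ z ∈ X, ‖z - x r‖ < δ →
      ‖F z r - F (x r) r - fderivWithin ℝ (fun y => F y r) X (x r) (z - x r)‖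
        ≤ η * ‖z - x r‖ := by
  -- X need not be compact, but the graph of x over the time interval is: a radius found near each
  -- time is patched into a uniform one.
  have hunif : ∃ δ > 0, ∀ r ∈ Icc s t, ∀ z ∈ X, ‖z - x r‖ < δ →
      ‖fderivWithin ℝ (fun y => F y r) X z - fderivWithin ℝ (fun y => F y r) X (x r)‖ ≤ η := by
    refine isCompact_Icc.induction_on (p := fun T => ∃ δ > 0, ∀ r ∈ T, ∀ z ∈ X, ‖z - x r‖ < δ →
      ‖fderivWithin ℝ (fun y => F y r) X z - fderivWithin ℝ (fun y => F y r) X (x r)‖ ≤ η)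
      ⟨1, one_pos, by simp⟩ ?_ ?_ ?_
    · rintro T T' hTT ⟨δ, hδ, h⟩
      exact ⟨δ, hδ, fun r hr => h r (hTT hr)⟩
    · rintro T T' ⟨δ, hδ, h⟩ ⟨δ', hδ', h'⟩
      refine ⟨min δ δ', lt_min hδ hδ', ?_⟩
      rintro r (hr | hr) z hz hzx
      · exact h r hr z hz (hzx.trans_le (min_le_left _ _))
      · exact h' r hr z hz (hzx.trans_le (min_le_right _ _))
    · intro r₀ hr₀
      have hc := Metric.continuousWithinAt_iff.1
        (hJ (x r₀, r₀) ⟨hxX r₀ hr₀, hr₀⟩) (η / 2) (half_pos hη)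
      obtain ⟨δ, hδ, hc⟩ := hc
      have hx₀ := Metric.continuousWithinAt_iff.1 (hx r₀ hr₀) (δ / 2) (half_pos hδ)
      obtain ⟨τ, hτ, hx₀⟩ := hx₀
      refine ⟨Metric.ball r₀ (min τ δ) ∩ Icc s t,
        inter_mem (mem_nhdsWithin_of_mem_nhds (Metric.ball_mem_nhds _ (lt_min hτ hδ)))
          self_mem_nhdsWithin, δ / 2, half_pos hδ, ?_⟩
      rintro r ⟨hr, hrI⟩ z hz hzx
      have hr1 : dist r r₀ < τ := hr.trans_le (min_le_left _ _)
      have hr2 : dist r r₀ < δ := hr.trans_le (min_le_right _ _)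
      have hxr := hx₀ hrI hr1
      have hzr : dist z (x r₀) < δ := by
        have := dist_triangle z (x r) (x r₀)
        rw [← dist_eq_norm] at hzx
        linarith
      have h1 := hc (x := (z, r)) ⟨hz, hrI⟩ (by simp [Prod.dist_eq, hzr, hr2])
      have h2 := hc (x := (x r, r)) ⟨hxX r hrI, hrI⟩
        (by simp only [Prod.dist_eq]; exact max_lt (by linarith) hr2)
      rw [← dist_eq_norm]
      have h3 := dist_triangle_right (fderivWithin ℝ (fun y => F y r) X z)
        (fderivWithin ℝ (fun y => F y r) X (x r)) (fderivWithin ℝ (fun y => F y r₀) X (x r₀))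
      simp only at h1 h2
      linarith
  obtain ⟨δ, hδ, h⟩ := hunif
  refine ⟨δ, hδ, fun r hr z hz hzx => ?_⟩
  have hd : ∀ y ∈ X ∩ Metric.ball (x r) δ,
      HasFDerivWithinAt (fun y => F y r) (fderivWithin ℝ (fun y => F y r) X y)
        (X ∩ Metric.ball (x r) δ) y := fun y hy =>
    ((hF r hr y hy.1).hasFDerivWithinAt).mono inter_subset_left
  -- Mean value inequality on the convex set X ∩ ball, applied to the field minus its linearization
  -- at x r.
  refine Convex.norm_image_sub_le_of_norm_hasFDerivWithin_le' hd
    (fun y hy => h r hr y hy.1 (by rw [← dist_eq_norm]; exact hy.2))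
    (hX.inter (convex_ball _ _)) ⟨hxX r hr, Metric.mem_ball_self hδ⟩
    ⟨hz, by rw [Metric.mem_ball, dist_eq_norm]; exact hzx⟩

/-! ### Quadratic forms of the metric -/

theorem LoewnerLE.dotProduct_le {n : ℕ} {A B : Matrix (Fin n) (Fin n) ℝ} (h : LoewnerLE A B)
    (v : Fin n → ℝ) : v ⬝ᵥ A *ᵥ v ≤ v ⬝ᵥ B *ᵥ v := by
  have := Matrix.PosSemidef.dotProduct_mulVec_nonneg h v
  simp only [star_trivial, Matrix.sub_mulVec, dotProduct_sub] at this
  linarith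

theorem dotProduct_gram_mulVec {n : ℕ} (T : Matrix (Fin n) (Fin n) ℝ) (u v : Fin n → ℝ) :
    u ⬝ᵥ (Tᵀ * T) *ᵥ v = (T *ᵥ u) ⬝ᵥ (T *ᵥ v) := by
  rw [← Matrix.mulVec_mulVec, Matrix.dotProduct_mulVec, Matrix.vecMul_transpose]

/-- The growth rate of the quadratic form `eᵀ M e` when `e` solves the linearized equation up to
a remainder `R`. -/
theorem quadratic_growth_le {n : ℕ} {M Mdot A T : Matrix (Fin n) (Fin n) ℝ} {α mlo mhi η : ℝ}
    (hmlo : 0 < mlo) (hmhi : 0 < mhi) (hη : 0 ≤ η) (hM : M = Tᵀ * T)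
    (hlo : LoewnerLE (mlo • 1) M) (hhi : LoewnerLE M (mhi • 1))
    (hcon : LoewnerLE (Mdot + (2 : ℝ) • symPart (M * A)) ((2 * α) • M))
    (e R : Euc n) (hR : ‖R‖ ≤ η * ‖e‖) :
    (A *ᵥ e + (R : Fin n → ℝ)) ⬝ᵥ M *ᵥ e + (e : Fin n → ℝ) ⬝ᵥ Mdot *ᵥ e
        + (e : Fin n → ℝ) ⬝ᵥ M *ᵥ (A *ᵥ e + (R : Fin n → ℝ))
      ≤ (2 * α + 2 * (mhi * η / mlo)) * ((e : Fin n → ℝ) ⬝ᵥ M *ᵥ e) := by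
  have hsymm : ∀ u v : Fin n → ℝ, u ⬝ᵥ M *ᵥ v = v ⬝ᵥ M *ᵥ u := fun u v => by
    rw [hM, dotProduct_gram_mulVec, dotProduct_gram_mulVec, dotProduct_comm]
  have hT : ∀ v : Euc n, ‖(WithLp.toLp 2 (T *ᵥ v) : Euc n)‖ ^ 2 ≤ mhi * ‖v‖ ^ 2 := fun v => by
    have h := hhi.dotProduct_le v
    rw [hM, dotProduct_gram_mulVec, Matrix.smul_mulVec, Matrix.one_mulVec, dotProduct_smul,
      Euc.dotProduct_self v, smul_eq_mul] at h
    rwa [← Euc.dotProduct_self (WithLp.toLp 2 (T *ᵥ v))]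
  have hlow : mlo * ‖e‖ ^ 2 ≤ (e : Fin n → ℝ) ⬝ᵥ M *ᵥ e := by
    have h := hlo.dotProduct_le e
    rwa [Matrix.smul_mulVec, Matrix.one_mulVec, dotProduct_smul, Euc.dotProduct_self,
      smul_eq_mul] at h
  -- Cauchy–Schwarz for the inner product of M, through the factor T.
  have hcr : (e : Fin n → ℝ) ⬝ᵥ M *ᵥ R ≤ mhi * η * ‖e‖ ^ 2 := by
    rw [hM, dotProduct_gram_mulVec]
    have h1 := real_inner_le_norm (WithLp.toLp 2 (T *ᵥ R) : Euc n)
      (WithLp.toLp 2 (T *ᵥ e) : Euc n)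
    rw [EuclideanSpace.inner_eq_star_dotProduct] at h1
    simp only [star_trivial] at h1
    have h2 : ‖(WithLp.toLp 2 (T *ᵥ R) : Euc n)‖ * ‖(WithLp.toLp 2 (T *ᵥ e) : Euc n)‖
        ≤ mhi * η * ‖e‖ ^ 2 := by
      refine le_of_sq_le_sq ?_ (by positivity)
      have hR2 : ‖R‖ ^ 2 ≤ (η * ‖e‖) ^ 2 := by gcongr
      calc _ = ‖(WithLp.toLp 2 (T *ᵥ R) : Euc n)‖ ^ 2 * ‖(WithLp.toLp 2 (T *ᵥ e) : Euc n)‖ ^ 2 := by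
            ring
        _ ≤ (mhi * (η * ‖e‖) ^ 2) * (mhi * ‖e‖ ^ 2) := by
            gcongr
            · exact (hT R).trans (by gcongr)
            · exact hT e
        _ = _ := by ring
    exact h1.trans h2
  have hc := hcon.dotProduct_le e
  simp only [symPart, smul_smul, Matrix.add_mulVec, Matrix.smul_mulVec, dotProduct_add,
    dotProduct_smul, smul_eq_mul] at hc
  have htr : (e : Fin n → ℝ) ⬝ᵥ (M * A)ᵀ *ᵥ e = (e : Fin n → ℝ) ⬝ᵥ M *ᵥ (A *ᵥ e) := by
    rw [Matrix.mulVec_transpose, dotProduct_comm, ← Matrix.dotProduct_mulVec,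
      ← Matrix.mulVec_mulVec]
  rw [htr, ← Matrix.mulVec_mulVec] at hc
  rw [hsymm (A *ᵥ e + (R : Fin n → ℝ))]
  simp only [Matrix.mulVec_add, dotProduct_add]
  have hfin : mhi * η * ‖e‖ ^ 2 ≤ mhi * η / mlo * ((e : Fin n → ℝ) ⬝ᵥ M *ᵥ e) := by
    rw [div_mul_eq_mul_div, le_div_iff₀ hmlo]
    have : 0 ≤ mhi * η := by positivity
    nlinarith
  linarith

/-! ### Lipschitz bound for the nominal flow -/

namespace IsContractionMetric

variable {n : ℕ} {X : Set (Euc n)} {I : Set ℝ} {F : Euc n → ℝ → Euc n}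
  {M Θ : Euc n → ℝ → Matrix (Fin n) (Fin n) ℝ} {α mlo mhi : ℝ}

theorem differentiableWithinAt (hM : IsContractionMetric X I F M Θ α mlo mhi) (i j : Fin n)
    {z : Euc n × ℝ} (hz : z ∈ X ×ˢ I) :
    DifferentiableWithinAt ℝ (fun z : Euc n × ℝ => M z.1 z.2 i j) (X ×ˢ I) z := by
  have hΘ : ∀ i j, DifferentiableWithinAt ℝ (fun z : Euc n × ℝ => Θ z.1 z.2 i j) (X ×ˢ I) z :=
    fun i j => (hM.smooth i j).differentiableOn one_ne_zero z hz
  have h : DifferentiableWithinAt ℝ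
      (fun z : Euc n × ℝ => ∑ k, Θ z.1 z.2 k i * Θ z.1 z.2 k j) (X ×ˢ I) z :=
    DifferentiableWithinAt.fun_sum fun k _ => (hΘ k i).mul (hΘ k j)
  have heq : ∀ y ∈ X ×ˢ I, M y.1 y.2 i j = ∑ k, Θ y.1 y.2 k i * Θ y.1 y.2 k j := fun y hy => by
    rw [hM.factor y.1 hy.1 y.2 hy.2, Matrix.mul_apply]
    rfl
  exact DifferentiableWithinAt.congr h heq (heq z hz)

theorem lower_sq (hM : IsContractionMetric X I F M Θ α mlo mhi) {x : Euc n} {t : ℝ}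
    (hx : x ∈ X) (ht : t ∈ I) (e : Euc n) :
    mlo * ‖e‖ ^ 2 ≤ (e : Fin n → ℝ) ⬝ᵥ M x t *ᵥ (e : Fin n → ℝ) := by
  have h := (hM.lower x hx t ht).dotProduct_le e
  rwa [Matrix.smul_mulVec, Matrix.one_mulVec, dotProduct_smul, Euc.dotProduct_self,
    smul_eq_mul] at h

theorem upper_sq (hM : IsContractionMetric X I F M Θ α mlo mhi) {x : Euc n} {t : ℝ}
    (hx : x ∈ X) (ht : t ∈ I) (e : Euc n) :
    (e : Fin n → ℝ) ⬝ᵥ M x t *ᵥ (e : Fin n → ℝ) ≤ mhi * ‖e‖ ^ 2 := by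
  have h := (hM.upper x hx t ht).dotProduct_le e
  rwa [Matrix.smul_mulVec, Matrix.one_mulVec, dotProduct_smul, Euc.dotProduct_self e,
    smul_eq_mul] at h

/-- Trajectories that start close enough to a given one separate from it at a rate at most
`α + ε`, up to the condition number of the metric. -/
theorem exists_expansion_near (hM : IsContractionMetric X I F M Θ α mlo mhi)
    (hX : Convex ℝ X) (hXint : (interior X).Nonempty) (hmlo : 0 < mlo) (hmhi : 0 < mhi)
    (hF : ∀ t ∈ I, DifferentiableOn ℝ (fun y => F y t) X)
    (hJ : ∀ i j, ContinuousOn (fun z : Euc n × ℝ => jacobian X F z.1 z.2 i j) (X ×ˢ I))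
    {s t : ℝ} (hst : s < t) (hI : Icc s t ⊆ I) {x : ℝ → Euc n} (hxX : ∀ r ∈ Icc s t, x r ∈ X)
    (hx : ∀ r ∈ Icc s t, HasDerivWithinAt x (F (x r) r) (Icc s t) r) {ε : ℝ} (hε : 0 < ε) :
    ∃ δ > 0, ∀ z : ℝ → Euc n, (∀ r ∈ Icc s t, z r ∈ X) →
      (∀ r ∈ Icc s t, HasDerivWithinAt z (F (z r) r) (Icc s t) r) →
      z s ≠ x s → ‖z s - x s‖ < δ →
      ‖z t - x t‖ ≤ Real.sqrt (mhi / mlo) * Real.exp ((α + ε) * (t - s)) * ‖z s - x s‖ := by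
  -- Chosen so that the remainder adds exactly ε to the growth rate 2α of V.
  have hη : 0 < ε * mlo / (2 * mhi) := by positivity
  obtain ⟨δ₁, hδ₁, hlin⟩ := exists_uniform_linearization hX (fun r hr => hF r (hI hr))
    ((continuousOn_fderivWithin_of_jacobian hJ).mono (prod_mono_right hI))
    (fun r hr => (hx r hr).continuousWithinAt) hxX hη
  set K := Real.exp (|2 * α + 2 * ε| * (t - s)) with hK
  have hKpos : 0 < K := Real.exp_pos _
  -- With this radius, V ≤ mhi |e(s)|² K forces |e| < δ₁; K dominates the exponential barrier on the
  -- whole interval.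
  refine ⟨δ₁ * Real.sqrt (mlo / (mhi * K)), by positivity, fun z hzX hz hne hclose => ?_⟩
  have hes : 0 < ‖z s - x s‖ := norm_pos_iff.2 (sub_ne_zero.2 hne)
  set e : ℝ → Euc n := fun r => z r - x r with he
  have he' : ∀ r ∈ Icc s t, HasDerivWithinAt e (F (z r) r - F (x r) r) (Icc s t) r :=
    fun r hr => (hz r hr).sub (hx r hr)
  have hcomp : ∀ r ∈ Icc s t, ∀ i,
      HasDerivWithinAt (fun r => e r i) ((F (z r) r - F (x r) r) i) (Icc s t) r := by
    intro r hr i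
    exact (EuclideanSpace.proj (𝕜 := ℝ) i).hasFDerivAt.comp_hasDerivWithinAt r (he' r hr)
  have hMd : ∀ r ∈ Icc s t, ∀ i j, HasDerivWithinAt (fun τ => M (x τ) τ i j)
      (metricDot X I F M (x r) r i j) (Icc s t) r := fun r hr i j =>
    hasDerivWithinAt_metric_along (uniqueDiffOn_convex hX hXint _ (hxX r hr))
      ((uniqueDiffOn_Icc hst r hr).mono hI) hxX hI hr (hx r hr) i j
      (hM.differentiableWithinAt i j ⟨hxX r hr, hI hr⟩)
  set V : ℝ → ℝ := fun r => (e r : Fin n → ℝ) ⬝ᵥ M (x r) r *ᵥ (e r : Fin n → ℝ) with hV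
  set V' : ℝ → ℝ := fun r =>
    ((F (z r) r - F (x r) r : Euc n) : Fin n → ℝ) ⬝ᵥ M (x r) r *ᵥ (e r : Fin n → ℝ)
      + (e r : Fin n → ℝ) ⬝ᵥ metricDot X I F M (x r) r *ᵥ (e r : Fin n → ℝ)
      + (e r : Fin n → ℝ) ⬝ᵥ M (x r) r *ᵥ ((F (z r) r - F (x r) r : Euc n) : Fin n → ℝ)
    with hV'
  have hVd : ∀ r ∈ Icc s t, HasDerivWithinAt V (V' r) (Icc s t) r := by
    intro r hr
    have h : HasDerivWithinAt (fun r => ∑ i, e r i * ∑ j, M (x r) r i j * e r j) _ (Icc s t) r :=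
      HasDerivWithinAt.fun_sum fun i _ => (hcomp r hr i).mul
        (HasDerivWithinAt.fun_sum fun j _ => (hMd r hr i j).mul (hcomp r hr j))
    refine h.congr_deriv ?_
    simp only [hV', dotProduct, Matrix.mulVec, Finset.sum_add_distrib, mul_add]
    ring
  have hVle : ∀ r ∈ Icc s t, ‖e r‖ < δ₁ → V' r ≤ (2 * α + ε) * V r := by
    intro r hr hsmall
    have h1 := hlin r hr (z r) (hzX r hr) hsmall
    have h2 := quadratic_growth_le hmlo hmhi hη.le (hM.factor _ (hxX r hr) _ (hI hr))
      (hM.lower _ (hxX r hr) _ (hI hr)) (hM.upper _ (hxX r hr) _ (hI hr))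
      (hM.contraction _ (hxX r hr) _ (hI hr)) (e r) _ h1
    have h3 : ((F (z r) r - F (x r) r : Euc n) : Fin n → ℝ)
        = jacobian X F (x r) r *ᵥ (e r : Fin n → ℝ)
          + ((F (z r) r - F (x r) r - fderivWithin ℝ (fun y => F y r) X (x r) (z r - x r) :
            Euc n) : Fin n → ℝ) := by
      rw [fderivWithin_apply_eq_jacobian_mulVec]
      ext i
      simp [he]
    have h4 : 2 * α + 2 * (mhi * (ε * mlo / (2 * mhi)) / mlo) = 2 * α + ε := by
      field_simp
    rw [← h3, h4] at h2
    exact h2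
  -- Smallness of e is needed only where V meets the barrier, and there the equality itself yields
  -- it, so no exit-time argument is required. Strictness comes from 2α + ε < 2α + 2ε together with
  -- V > 0, which uses distinct starting points.
  have hfence : V t ≤ mhi * ‖z s - x s‖ ^ 2 * Real.exp ((2 * α + 2 * ε) * (t - s)) := by
    refine image_le_of_deriv_right_lt_deriv_boundary' (f := V) (f' := V') (a := s) (b := t)
      (B := fun r => mhi * ‖z s - x s‖ ^ 2 * Real.exp ((2 * α + 2 * ε) * (r - s)))
      (B' := fun r => (2 * α + 2 * ε)
        * (mhi * ‖z s - x s‖ ^ 2 * Real.exp ((2 * α + 2 * ε) * (r - s))))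
      (fun r hr => (hVd r hr).continuousWithinAt)
      (fun r hr => (hVd r (Ico_subset_Icc_self hr)).mono_of_mem_nhdsWithin
        (Icc_mem_nhdsGE_of_mem hr))
      ?_ (by fun_prop) ?_ ?_ (right_mem_Icc.2 hst.le)
    · have hs : s ∈ Icc s t := left_mem_Icc.2 hst.le
      simpa [hV] using hM.upper_sq (hxX s hs) (hI hs) (e s)
    · intro r _
      have h1 := (((((hasDerivWithinAt_id r (Ici r)).sub_const s).const_mul
        (2 * α + 2 * ε)).exp).const_mul (mhi * ‖z s - x s‖ ^ 2))
      refine h1.congr_deriv ?_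
      simp only [id]
      ring
    · intro r hr hVB
      have hr' := Ico_subset_Icc_self hr
      have hlow := hM.lower_sq (hxX r hr') (hI hr') (e r)
      have hVpos : 0 < V r := by rw [hVB]; positivity
      have hsmall : ‖e r‖ < δ₁ := by
        refine lt_of_pow_lt_pow_left₀ 2 hδ₁.le ?_
        have hexp : Real.exp ((2 * α + 2 * ε) * (r - s)) ≤ K := by
          refine Real.exp_le_exp.2 ?_
          have h1 : 0 ≤ r - s := sub_nonneg.2 hr.1
          have h2 : r - s ≤ t - s := by linarith [hr.2]
          exact (mul_le_mul_of_nonneg_right (le_abs_self _) h1).trans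
            (mul_le_mul_of_nonneg_left h2 (abs_nonneg _))
        have hsq : ‖z s - x s‖ ^ 2 < δ₁ ^ 2 * (mlo / (mhi * K)) := by
          have := pow_lt_pow_left₀ hclose (norm_nonneg _) two_ne_zero
          rwa [mul_pow, Real.sq_sqrt (by positivity)] at this
        have h5 : mlo * ‖e r‖ ^ 2 ≤ mhi * ‖z s - x s‖ ^ 2 * K := by
          refine hlow.trans ?_
          change V r ≤ _
          rw [hVB]
          gcongr
        have h6 : mhi * ‖z s - x s‖ ^ 2 * K < mlo * δ₁ ^ 2 := by
          have h7 : mhi * ‖z s - x s‖ ^ 2 * K = (mhi * K) * ‖z s - x s‖ ^ 2 := by ring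
          have h8 : mlo * δ₁ ^ 2 = (mhi * K) * (δ₁ ^ 2 * (mlo / (mhi * K))) := by field_simp
          rw [h7, h8]
          exact mul_lt_mul_of_pos_left hsq (by positivity)
        exact lt_of_mul_lt_mul_left (h5.trans_lt h6) hmlo.le
      refine (hVle r hr' hsmall).trans_lt ?_
      rw [← hVB]
      nlinarith
  have ht : t ∈ Icc s t := right_mem_Icc.2 hst.le
  have hlow := hM.lower_sq (hxX t ht) (hI ht) (e t)
  refine le_of_sq_le_sq ?_ (by positivity)
  rw [mul_pow, mul_pow, Real.sq_sqrt (by positivity), ← Real.exp_nat_mul]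
  have h1 : ((2 : ℕ) : ℝ) * ((α + ε) * (t - s)) = (2 * α + 2 * ε) * (t - s) := by
    push_cast; ring
  rw [h1, div_mul_eq_mul_div, div_mul_eq_mul_div, le_div_iff₀ hmlo]
  have h2 := hlow.trans hfence
  simp only [he] at h2
  linarith

/-- The nominal flow is Lipschitz, with constant `√(mhi / mlo) e^{α (t - s)}`. -/
theorem norm_flow_sub_le (hM : IsContractionMetric X I F M Θ α mlo mhi)
    (hX : Convex ℝ X) (hXint : (interior X).Nonempty) (hmlo : 0 < mlo) (hmhi : 0 < mhi)
    (hIc : I.OrdConnected) (hF : ∀ t ∈ I, DifferentiableOn ℝ (fun y => F y t) X)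
    (hJ : ∀ i j, ContinuousOn (fun z : Euc n × ℝ => jacobian X F z.1 z.2 i j) (X ×ˢ I))
    {Φ : ℝ → ℝ → X → X} (hΦ : IsFlow X I F Φ) {s t : ℝ} (hs : s ∈ I) (ht : t ∈ I) (hst : s ≤ t)
    (a b : X) :
    ‖(Φ s t b : Euc n) - Φ s t a‖
      ≤ Real.sqrt (mhi / mlo) * Real.exp (α * (t - s)) * ‖(b : Euc n) - a‖ := by
  rcases hst.eq_or_lt with rfl | hlt
  -- On a one-point time interval derivatives are not unique; here the two metric bounds suffice.
  · rw [hΦ.init s hs, hΦ.init s hs]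
    have h1 := (hM.lower_sq a.2 hs ((b : Euc n) - a)).trans (hM.upper_sq a.2 hs _)
    refine le_of_sq_le_sq ?_ (by positivity)
    rw [mul_pow, mul_pow, Real.sq_sqrt (by positivity), div_mul_eq_mul_div, div_mul_eq_mul_div,
      le_div_iff₀ hmlo]
    simp only [sub_self, mul_zero, Real.exp_zero]
    linarith
  have hI : Icc s t ⊆ I := hIc.out hs ht
  have hode : ∀ y : X, ∀ r ∈ Icc s t,
      HasDerivWithinAt (fun r => (Φ s r y : Euc n)) (F (Φ s r y) r) (Icc s t) r :=
    fun y r hr => (hΦ.ode s hs r (hI hr) hr.1 y).mono fun τ hτ => ⟨hI hτ, hτ.1⟩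
  have hloc : ∀ ε > 0, ∀ y : X, ∃ δ > 0, ∀ z : X, ‖(z : Euc n) - y‖ < δ →
      ‖(Φ s t z : Euc n) - Φ s t y‖
        ≤ Real.sqrt (mhi / mlo) * Real.exp ((α + ε) * (t - s)) * ‖(z : Euc n) - y‖ := by
    intro ε hε y
    obtain ⟨δ, hδ, h⟩ := hM.exists_expansion_near hX hXint hmlo hmhi hF hJ hlt hI
      (fun r _ => (Φ s r y).2) (hode y) hε
    refine ⟨δ, hδ, fun z hz => ?_⟩
    by_cases hzy : z = y
    · subst hzy; simp
    · have := h (fun r => Φ s r z) (fun r _ => (Φ s r z).2) (hode z)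
      simp only [hΦ.init s hs] at this
      exact this (fun h => hzy (Subtype.ext h)) hz
  have hε : ∀ ε > 0, ‖(Φ s t b : Euc n) - Φ s t a‖
      ≤ Real.sqrt (mhi / mlo) * Real.exp ((α + ε) * (t - s)) * ‖(b : Euc n) - a‖ := by
    intro ε hε
    set C := Real.sqrt (mhi / mlo) * Real.exp ((α + ε) * (t - s)) with hC
    have hC0 : 0 ≤ C := by positivity
    -- Clamping the parameter makes the segment a curve in X defined on all of ℝ.
    set proj : ℝ → Icc (0 : ℝ) 1 := projIcc 0 1 zero_le_one with hproj
    have hseg : ∀ l ∈ Icc (0 : ℝ) 1, (a : Euc n) + l • ((b : Euc n) - a) ∈ X :=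
      fun l hl => hX.add_smul_sub_mem a.2 b.2 hl
    set c : ℝ → X := fun l => ⟨a + (proj l : ℝ) • ((b : Euc n) - a), hseg _ (proj l).2⟩ with hc
    have hcval : ∀ l ∈ Icc (0 : ℝ) 1, (c l : Euc n) = a + l • ((b : Euc n) - a) := by
      intro l hl
      simp [hc, hproj, projIcc_of_mem _ hl]
    have hcsub : ∀ l ∈ Icc (0 : ℝ) 1, ∀ l' ∈ Icc (0 : ℝ) 1,
        ‖(c l' : Euc n) - c l‖ = |l' - l| * ‖(b : Euc n) - a‖ := by
      intro l hl l' hl'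
      rw [hcval l hl, hcval l' hl', add_sub_add_left_eq_sub, ← sub_smul, norm_smul,
        Real.norm_eq_abs]
    -- The radius depends on the base point, so the bound is only infinitesimal; it supplies both
    -- the continuity and the slope bound for the mean value inequality.
    have hnear : ∀ l ∈ Icc (0 : ℝ) 1, ∀ᶠ l' in 𝓝[Icc 0 1] l,
        ‖(Φ s t (c l') : Euc n) - Φ s t (c l)‖ ≤ C * ‖(b : Euc n) - a‖ * |l' - l| := by
      intro l hl
      obtain ⟨δ, hδ, h⟩ := hloc ε hε (c l)
      have hlim : Tendsto (fun l' => |l' - l| * ‖(b : Euc n) - a‖) (𝓝[Icc 0 1] l) (𝓝 0) := by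
        have : Continuous fun l' : ℝ => |l' - l| * ‖(b : Euc n) - a‖ := by fun_prop
        simpa using (this.tendsto l).mono_left nhdsWithin_le_nhds
      filter_upwards [hlim.eventually_lt_const hδ, self_mem_nhdsWithin] with l' h1 hl'
      have h2 := h (c l') (by rw [hcsub l hl l' hl']; exact h1)
      rw [hcsub l hl l' hl'] at h2
      linarith
    have hmain := norm_sub_le_of_right_quotient_le (g := fun l => (Φ s t (c l) : Euc n))
      (B := fun l => C * ‖(b : Euc n) - a‖ * l) (B' := fun _ => C * ‖(b : Euc n) - a‖)
      zero_le_one ?_ (by fun_prop) ?_ ?_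
    · have h0 : c 0 = a := Subtype.ext (by rw [hcval 0 (by simp)]; simp)
      have h1 : c 1 = b := Subtype.ext (by rw [hcval 1 (by simp)]; simp)
      simpa [h0, h1] using hmain
    · intro l hl
      rw [ContinuousWithinAt, tendsto_iff_norm_sub_tendsto_zero]
      refine squeeze_zero' (Eventually.of_forall fun _ => norm_nonneg _) (hnear l hl) ?_
      have : Continuous fun l' : ℝ => C * ‖(b : Euc n) - a‖ * |l' - l| := by fun_prop
      simpa using (this.tendsto l).mono_left (nhdsWithin_le_nhds (s := Icc (0 : ℝ) 1))
    · intro l _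
      simpa using (hasDerivWithinAt_id l (Ici l)).const_mul (C * ‖(b : Euc n) - a‖)
    · intro l hl r hr
      have h1 : 𝓝[>] l ≤ 𝓝[Icc 0 1] l :=
        nhdsWithin_le_of_mem (Icc_mem_nhdsGT_of_mem hl)
      refine (((hnear l (Ico_subset_Icc_self hl)).filter_mono h1).and
        self_mem_nhdsWithin).frequently.mono ?_
      rintro l' ⟨h2, h3⟩
      have h4 : 0 < l' - l := sub_pos.2 h3
      rw [abs_of_pos h4] at h2
      exact h2.trans (by gcongr)
  have hlim : Tendsto (fun ε => Real.sqrt (mhi / mlo) * Real.exp ((α + ε) * (t - s))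
      * ‖(b : Euc n) - a‖) (𝓝[>] 0)
      (𝓝 (Real.sqrt (mhi / mlo) * Real.exp (α * (t - s)) * ‖(b : Euc n) - a‖)) := by
    have : Continuous fun ε : ℝ => Real.sqrt (mhi / mlo) * Real.exp ((α + ε) * (t - s))
      * ‖(b : Euc n) - a‖ := by fun_prop
    simpa using (this.tendsto 0).mono_left nhdsWithin_le_nhds
  exact ge_of_tendsto hlim (eventually_mem_nhdsWithin.mono fun ε h => hε ε h)

end IsContractionMetric

/-! ### Perturbation of a flow -/

namespace IsFlow

variable {n : ℕ} {X : Set (Euc n)} {I : Set ℝ} {F v : Euc n → ℝ → Euc n} {Φ Ψ : ℝ → ℝ → X → X}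

theorem hasDerivWithinAt_Icc (hΦ : IsFlow X I F Φ) (hI : I.OrdConnected) {s t : ℝ} (hs : s ∈ I)
    (ht : t ∈ I) (y : X) {r : ℝ} (hr : r ∈ Icc s t) :
    HasDerivWithinAt (fun r => (Φ s r y : Euc n)) (F (Φ s r y) r) (Icc s t) r :=
  (hΦ.ode s hs r (hI.out hs ht hr) hr.1 y).mono fun _ hτ => ⟨hI.out hs ht hτ, hτ.1⟩

/-- Flow lines that start near a given space-time point move with bounded speed. -/
theorem exists_local_speed_bound (hΦ : IsFlow X I F Φ) (hI : I.OrdConnected)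
    (hF : ContinuousOn (fun z : Euc n × ℝ => F z.1 z.2) (X ×ˢ I)) {x₀ : Euc n} {s₀ : ℝ}
    (hx₀ : x₀ ∈ X) (hs₀ : s₀ ∈ I) :
    ∃ C τ : ℝ, 0 < τ ∧ ∀ s₁ ∈ I, ∀ s₂ ∈ I, s₁ ≤ s₂ → |s₁ - s₀| < τ → |s₂ - s₀| < τ →
      ∀ y : X, ‖(y : Euc n) - x₀‖ < τ → ‖(Φ s₁ s₂ y : Euc n) - y‖ ≤ C * (s₂ - s₁) := by
  obtain ⟨δ, hδ, h⟩ := Metric.continuousWithinAt_iff.1 (hF (x₀, s₀) ⟨hx₀, hs₀⟩) 1 one_pos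
  set C : ℝ := ‖F x₀ s₀‖ + 2 with hC
  have hC0 : 0 < C := by positivity
  -- Starting offset at most δ/2 plus travel C · 2τ ≤ δ/2 stays in the δ-ball, where the speed is
  -- below C.
  set τ := min (δ / 2) (δ / (4 * C)) with hτ
  have hτ1 : τ ≤ δ / 2 := min_le_left _ _
  have hτ2 : C * (2 * τ) ≤ δ / 2 := by
    have h1 : τ ≤ δ / (4 * C) := min_le_right _ _
    rw [le_div_iff₀ (by positivity)] at h1
    linarith
  refine ⟨C, τ, lt_min (by positivity) (by positivity), ?_⟩
  intro s₁ hs₁ s₂ hs₂ h12 hd₁ hd₂ y hy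
  rw [abs_lt] at hd₁ hd₂
  have hder := fun r (hr : r ∈ Icc s₁ s₂) => hΦ.hasDerivWithinAt_Icc hI hs₁ hs₂ y hr
  refine image_norm_le_of_norm_deriv_right_lt_deriv_boundary'
    (f := fun r => (Φ s₁ r y : Euc n) - y) (f' := fun r => F (Φ s₁ r y) r) (a := s₁) (b := s₂)
    (B := fun r => C * (r - s₁)) (B' := fun _ => C)
    (fun r hr => ((hder r hr).sub_const _).continuousWithinAt)
    (fun r hr => ((hder r (Ico_subset_Icc_self hr)).sub_const _).mono_of_mem_nhdsWithin
      (Icc_mem_nhdsGE_of_mem hr)) (by simp [hΦ.init s₁ hs₁]) (by fun_prop) ?_ ?_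
    (right_mem_Icc.2 h12)
  · intro r _
    simpa using ((hasDerivWithinAt_id r (Ici r)).sub_const s₁).const_mul C
  · intro r hr hrB
    have hsmall : C * (r - s₁) ≤ C * (2 * τ) :=
      mul_le_mul_of_nonneg_left (by linarith [hr.2]) hC0.le
    have hdist : dist (Φ s₁ r y : Euc n) x₀ < δ := by
      rw [dist_eq_norm]
      have := norm_sub_le_norm_sub_add_norm_sub (Φ s₁ r y : Euc n) y x₀
      linarith
    have hrs : dist r s₀ < δ := by
      rw [Real.dist_eq, abs_lt]
      constructor <;> linarith [hr.1, hr.2]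
    have h1 := h (x := ((Φ s₁ r y : Euc n), r))
      ⟨(Φ s₁ r y).2, hI.out hs₁ hs₂ (Ico_subset_Icc_self hr)⟩
      (by rw [Prod.dist_eq]; exact max_lt hdist hrs)
    rw [dist_eq_norm] at h1
    have h2 := norm_le_norm_add_norm_sub' (F (Φ s₁ r y) r) (F x₀ s₀)
    simp only at h1
    linarith

/-- Variation of constants: if a flow expands distances by at most `k e^{α (t - s)}`, then
perturbing its field by at most `D` displaces the endpoints by at most
`k D ∫₀ᵗ e^{α (t - r)} dr`. -/
theorem norm_perturbed_sub_le (hΦ : IsFlow X I F Φ) (hΨ : IsFlow X I v Ψ) (hI : I.OrdConnected)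
    (hF : ContinuousOn (fun z : Euc n × ℝ => F z.1 z.2) (X ×ˢ I)) {k α D : ℝ} (hk : 0 ≤ k)
    (hexp : ∀ s ∈ I, ∀ t ∈ I, s ≤ t → ∀ a b : X,
      ‖(Φ s t b : Euc n) - Φ s t a‖ ≤ k * Real.exp (α * (t - s)) * ‖(b : Euc n) - a‖)
    (hD : ∀ x ∈ X, ∀ t ∈ I, ‖v x t - F x t‖ ≤ D) (h0 : (0 : ℝ) ∈ I) {t : ℝ} (ht : t ∈ I)
    (ht0 : 0 ≤ t) (y : X) :
    ‖(Ψ 0 t y : Euc n) - Φ 0 t y‖ ≤ k * D * ∫ r in (0 : ℝ)..t, Real.exp (α * (t - r)) := by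
  have hsub : Icc 0 t ⊆ I := hI.out h0 ht
  set c : ℝ → X := fun s => Ψ 0 s y with hc
  have hccont : ContinuousOn (fun s => (c s : Euc n)) (Icc 0 t) := fun s hs =>
    (hΨ.hasDerivWithinAt_Icc hI h0 ht y hs).continuousWithinAt
  -- By the semigroup law both endpoints are images under the same nominal map from time s₂.
  have hstep : ∀ s₁ ∈ Icc 0 t, ∀ s₂ ∈ Icc 0 t, s₁ ≤ s₂ →
      ‖(Φ s₂ t (c s₂) : Euc n) - Φ s₁ t (c s₁)‖
        ≤ k * Real.exp (α * (t - s₂)) * ‖(c s₂ : Euc n) - Φ s₁ s₂ (c s₁)‖ := by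
    intro s₁ h₁ s₂ h₂ h12
    rw [← hΦ.comp s₁ (hsub h₁) s₂ (hsub h₂) t ht h12 h₂.2]
    exact hexp s₂ (hsub h₂) t ht h₂.2 _ _
  have hmain := norm_sub_le_of_right_quotient_le (g := fun s => (Φ s t (c s) : Euc n))
    (B := fun s => k * D * ∫ r in (0 : ℝ)..s, Real.exp (α * (t - r)))
    (B' := fun s => k * D * Real.exp (α * (t - s))) ht0 ?_ ?_ ?_ ?_
  · simpa [hc, hΦ.init t ht, hΨ.init 0 h0] using hmain
  -- Continuity in the starting time is not part of `IsFlow`; it follows from the Lipschitz bound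
  -- and the local speed bound.
  · intro s₀ hs₀
    obtain ⟨C, τ, hτ, hspeed⟩ := hΦ.exists_local_speed_bound hI hF (c s₀).2 (hsub hs₀)
    set K := k * Real.exp (|α| * t) with hK
    have hK0 : 0 ≤ K := by positivity
    have hbound : ∀ s₁ ∈ Icc 0 t, ∀ s₂ ∈ Icc 0 t, s₁ ≤ s₂ → |s₁ - s₀| < τ → |s₂ - s₀| < τ →
        ‖(c s₁ : Euc n) - c s₀‖ < τ → ‖(Φ s₂ t (c s₂) : Euc n) - Φ s₁ t (c s₁)‖
          ≤ K * (‖(c s₂ : Euc n) - c s₁‖ + C * (s₂ - s₁)) := by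
      intro s₁ h₁ s₂ h₂ h12 hd₁ hd₂ hcd
      have h3 := hspeed s₁ (hsub h₁) s₂ (hsub h₂) h12 hd₁ hd₂ (c s₁) hcd
      have h4 : ‖(c s₂ : Euc n) - Φ s₁ s₂ (c s₁)‖
          ≤ ‖(c s₂ : Euc n) - c s₁‖ + ‖(Φ s₁ s₂ (c s₁) : Euc n) - c s₁‖ := by
        rw [norm_sub_rev (Φ s₁ s₂ (c s₁) : Euc n)]
        exact norm_sub_le_norm_sub_add_norm_sub ..
      have h5 : Real.exp (α * (t - s₂)) ≤ Real.exp (|α| * t) := by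
        refine Real.exp_le_exp.2 ?_
        exact (mul_le_mul_of_nonneg_right (le_abs_self _) (sub_nonneg.2 h₂.2)).trans
          (mul_le_mul_of_nonneg_left (by linarith [h₂.1]) (abs_nonneg _))
      calc _ ≤ _ := hstep s₁ h₁ s₂ h₂ h12
        _ ≤ K * ‖(c s₂ : Euc n) - Φ s₁ s₂ (c s₁)‖ := by rw [hK]; gcongr
        _ ≤ _ := by gcongr; linarith
    have hnorm : Tendsto (fun s => ‖(c s : Euc n) - c s₀‖) (𝓝[Icc 0 t] s₀) (𝓝 0) :=
      tendsto_iff_norm_sub_tendsto_zero.1 (hccont s₀ hs₀)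
    have habs : Tendsto (fun s => |s - s₀|) (𝓝[Icc 0 t] s₀) (𝓝 0) := by
      have : Continuous fun s : ℝ => |s - s₀| := by fun_prop
      simpa using (this.tendsto s₀).mono_left (nhdsWithin_le_nhds (s := Icc 0 t))
    rw [ContinuousWithinAt, tendsto_iff_norm_sub_tendsto_zero]
    refine squeeze_zero' (g := fun s => K * (‖(c s : Euc n) - c s₀‖ + C * |s - s₀|))
      (Eventually.of_forall fun _ => norm_nonneg _) ?_ ?_
    · filter_upwards [hnorm.eventually_lt_const hτ, habs.eventually_lt_const hτ,
        self_mem_nhdsWithin] with s h1 h2 hs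
      rcases le_total s s₀ with hle | hle
      · have := hbound s hs s₀ hs₀ hle h2 (by simpa using hτ) h1
        rw [norm_sub_rev, norm_sub_rev (c s : Euc n), abs_sub_comm, abs_of_nonneg (by linarith)]
        exact this
      · have := hbound s₀ hs₀ s hs hle (by simpa using hτ) h2 (by simpa using hτ)
        rwa [abs_of_nonneg (by linarith)]
    · simpa using (hnorm.add (habs.const_mul C)).const_mul K
  · intro s _
    have : Continuous fun r => Real.exp (α * (t - r)) := by fun_prop
    exact ((this.integral_hasStrictDerivAt 0 s).hasDerivAt.const_mul
      (k * D)).continuousAt.continuousWithinAt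
  · intro s _
    have : Continuous fun r => Real.exp (α * (t - r)) := by fun_prop
    exact ((this.integral_hasStrictDerivAt 0 s).hasDerivAt.const_mul (k * D)).hasDerivWithinAt
  · intro s hs R hR
    have hs' := Ico_subset_Icc_self hs
    obtain ⟨q, hq, hqD⟩ : ∃ q, k * Real.exp (α * (t - s)) * q < R ∧ D < q := by
      have h1 : Continuous fun q => k * Real.exp (α * (t - s)) * q := by fun_prop
      have h2 : ∀ᶠ q in 𝓝[>] D, k * Real.exp (α * (t - s)) * q < R :=
        ((h1.tendsto D).mono_left nhdsWithin_le_nhds).eventually_lt_const (by linarith)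
      exact (h2.and self_mem_nhdsWithin).exists
    have h1 : ∀ᶠ r in 𝓝[>] s, k * Real.exp (α * (t - r)) * q < R := by
      have h1 : Continuous fun r => k * Real.exp (α * (t - r)) * q := by fun_prop
      exact ((h1.tendsto s).mono_left nhdsWithin_le_nhds).eventually_lt_const hq
    -- Both curves leave c s at time s, so their gap starts at zero with velocity v - F, of norm at
    -- most D < q.
    have hd : HasDerivWithinAt (fun r => (c r : Euc n) - Φ s r (c s))
        (v (c s) s - F (c s) s) (Icc s t) s := by
      have hs1 := left_mem_Icc.2 hs'.2
      have h2 := (hΦ.hasDerivWithinAt_Icc hI (hsub hs') ht (c s) hs1)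
      rw [hΦ.init s (hsub hs')] at h2
      exact ((hΨ.hasDerivWithinAt_Icc hI h0 ht y hs').mono (Icc_subset_Icc_left hs'.1)).sub h2
    have h2 := hd.limsup_slope_norm_le ((hD _ (c s).2 s (hsub hs')).trans_lt hqD)
    have h3 : 𝓝[>] s ≤ 𝓝[Icc s t] s :=
      nhdsWithin_le_of_mem (Icc_mem_nhdsGT_of_mem ⟨le_rfl, hs.2⟩)
    refine Eventually.frequently ?_
    filter_upwards [h1, h2.filter_mono h3, self_mem_nhdsWithin,
      Icc_mem_nhdsGT_of_mem (⟨le_rfl, hs.2⟩ : s ∈ Ico s t)] with r hr1 hr2 hr3 hr4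
    have hpos : 0 < r - s := sub_pos.2 hr3
    rw [hΦ.init s (hsub hs'), sub_self, norm_zero, sub_zero, Real.norm_of_nonneg hpos.le,
      inv_mul_lt_iff₀ hpos] at hr2
    refine (hstep s hs' r ⟨hs'.1.trans hr4.1, hr4.2⟩ hr4.1).trans ?_
    calc _ ≤ k * Real.exp (α * (t - r)) * ((r - s) * q) := by gcongr
      _ = k * Real.exp (α * (t - r)) * q * (r - s) := by ring
      _ ≤ _ := by gcongr

end IsFlow

/-! ### Wasserstein estimates for push-forwards -/

/-- Push-forward of two laws by maps that are jointly Lipschitz up to an additive error. -/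
theorem W2_map_le {S : Type*} [PseudoEMetricSpace S] [SecondCountableTopology S]
    [MeasurableSpace S] [OpensMeasurableSpace S] {μ ν : Measure S} [IsProbabilityMeasure μ]
    {f g : S → S} (hf : Measurable f) (hg : Measurable g) {a b : ℝ≥0∞} (ha : a ≠ 0)
    (ha' : a ≠ ∞) (h : ∀ x y, edist (f x) (g y) ≤ a * edist x y + b) :
    W2 (μ.map f) (ν.map g) ≤ a * W2 μ ν + b := by
  have hcost : ∀ π : Measure (S × S), IsCoupling μ ν π →
      W2 (μ.map f) (ν.map g) ≤ a * (∫⁻ z, edist z.1 z.2 ^ 2 ∂π) ^ (1 / 2 : ℝ) + b := by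
    intro π hπ
    -- Total mass one makes the L² norm of the constant b equal to b.
    have hprob : π univ = 1 := by
      have h1 : μ univ = 1 := measure_univ
      rwa [← hπ.1, Measure.map_apply measurable_fst MeasurableSet.univ, preimage_univ] at h1
    have hfg : Measurable (Prod.map f g) := hf.prodMap hg
    have hpush : IsCoupling (μ.map f) (ν.map g) (π.map (Prod.map f g)) := by
      constructor
      · rw [Measure.map_map measurable_fst hfg, ← hπ.1, Measure.map_map hf measurable_fst]
        rfl
      · rw [Measure.map_map measurable_snd hfg, ← hπ.2, Measure.map_map hg measurable_snd]
        rfl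
    have hmeas : Measurable fun z : S × S => edist z.1 z.2 := measurable_edist
    calc W2 (μ.map f) (ν.map g)
        ≤ (∫⁻ z, edist z.1 z.2 ^ 2 ∂(π.map (Prod.map f g))) ^ (1 / 2 : ℝ) :=
          ENNReal.rpow_le_rpow (iInf₂_le _ hpush) (by norm_num)
      _ = (∫⁻ z, edist (f z.1) (g z.2) ^ 2 ∂π) ^ (1 / 2 : ℝ) := by
          rw [lintegral_map (hmeas.pow_const 2) hfg]
          rfl
      _ ≤ (∫⁻ z, (a * edist z.1 z.2 + b) ^ (2 : ℝ) ∂π)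
            ^ (1 / 2 : ℝ) := by
          refine ENNReal.rpow_le_rpow (lintegral_mono fun z => ?_) (by norm_num)
          rw [ENNReal.rpow_two]
          gcongr
          exact h z.1 z.2
      _ ≤ (∫⁻ z, (a * edist z.1 z.2) ^ (2 : ℝ) ∂π) ^ (1 / 2 : ℝ)
            + (∫⁻ _, b ^ (2 : ℝ) ∂π) ^ (1 / 2 : ℝ) :=
          ENNReal.lintegral_Lp_add_le (p := 2) (hmeas.const_mul a).aemeasurable
            aemeasurable_const one_le_two
      _ = _ := by
          have h2 : ∀ c : ℝ≥0∞, (c ^ (2 : ℝ)) ^ (1 / 2 : ℝ) = c := fun c => by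
            rw [← ENNReal.rpow_mul]; norm_num
          simp only [ENNReal.mul_rpow_of_nonneg _ _ (zero_le_two (α := ℝ))]
          rw [lintegral_const_mul _ (hmeas.pow_const _), lintegral_const, hprob, mul_one,
            ENNReal.mul_rpow_of_nonneg _ _ (by norm_num), h2, h2]
          simp only [ENNReal.rpow_two]
  -- The square root is an order isomorphism of [0, ∞], so it commutes with the infimum.
  have hinf : W2 μ ν = ⨅ π : {π : Measure (S × S) // IsCoupling μ ν π},
      (∫⁻ z, edist z.1 z.2 ^ 2 ∂(π : Measure (S × S))) ^ (1 / 2 : ℝ) := by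
    rw [W2, iInf_subtype']
    exact (ENNReal.orderIsoRpow (1 / 2) (by norm_num)).map_iInf _
  rw [hinf, ENNReal.mul_iInf_of_ne ha ha', ENNReal.iInf_add]
  exact le_iInf fun π => hcost π.1 π.2

/-- Push-forward by a measurable map of affine growth preserves finite second moments. -/
theorem IsP2.map {n : ℕ} {X : Set (Euc n)} {μ : Measure X} (hμ : IsP2 μ) {f : X → X}
    (hf : Measurable f) {a b : ℝ} (hab : ∀ x, ‖(f x : Euc n)‖ ≤ a * ‖(x : Euc n)‖ + b) :
    IsP2 (μ.map f) := by
  have := hμ.1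
  refine ⟨Measure.isProbabilityMeasure_map hf.aemeasurable, ?_⟩
  have hmeas : Measurable fun x : X => ‖(x : Euc n)‖ₑ := measurable_subtype_coe.enorm
  rw [lintegral_map (hmeas.pow_const 2) hf]
  have hle : ∀ x : X, ‖(f x : Euc n)‖ₑ ^ 2
      ≤ 2 * ‖a‖ₑ ^ 2 * ‖(x : Euc n)‖ₑ ^ 2 + 2 * ‖b‖ₑ ^ 2 := by
    intro x
    have h1 : ‖(f x : Euc n)‖ ^ 2 ≤ 2 * ‖a‖ ^ 2 * ‖(x : Euc n)‖ ^ 2 + 2 * ‖b‖ ^ 2 := by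
      have h2 := (sq_le_sq₀ (norm_nonneg _) ((norm_nonneg _).trans (hab x))).2 (hab x)
      simp only [Real.norm_eq_abs, sq_abs]
      nlinarith [sq_nonneg (a * ‖(x : Euc n)‖ - b)]
    have h3 := ENNReal.ofReal_le_ofReal h1
    rw [ENNReal.ofReal_add (by positivity) (by positivity), ENNReal.ofReal_mul (by positivity),
      ENNReal.ofReal_mul (by positivity), ENNReal.ofReal_mul (by positivity)] at h3
    simpa only [ENNReal.ofReal_pow (norm_nonneg _), ofReal_norm, ENNReal.ofReal_ofNat] using h3
  refine (lintegral_mono hle).trans_lt ?_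
  rw [lintegral_add_right _ measurable_const, lintegral_const_mul _ (hmeas.pow_const 2),
    lintegral_const, measure_univ, mul_one]
  refine ENNReal.add_lt_top.2 ⟨ENNReal.mul_lt_top ?_ hμ.2, ?_⟩ <;>
    exact ENNReal.mul_lt_top (by simp) (ENNReal.pow_lt_top enorm_lt_top)

end

/-! ### Assembly of the Wasserstein bound -/

theorem theorem2 {n m p q : ℕ}
    -- state space and time interval
    (X : Set (Euc n)) (hXconv : Convex ℝ X) (hXint : (interior X).Nonempty)
    (I : Set ℝ) (hI : I.OrdConnected) (hI0 : (0 : ℝ) ∈ I) (hIpos : I ⊆ Ici 0)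
    -- the system, the fault profile, and the positive Fokker-Planck solution
    (S : FaultSystem n m p q) (w : ℝ → Euc p) (ρ : Euc n → ℝ → ℝ)
    (hρ : S.IsPosFokkerPlanck X I w ρ)
    -- the nominal field is continuous, and continuously differentiable in the state
    (hFcont : ContinuousOn (fun z : Euc n × ℝ => S.nominal z.1 z.2) (X ×ˢ I))
    (hFdiff : ∀ t ∈ I, DifferentiableOn ℝ (fun x => S.nominal x t) X)
    (hFjac : ∀ i j,
      ContinuousOn (fun z : Euc n × ℝ => jacobian X S.nominal z.1 z.2 i j) (X ×ˢ I))
    -- the two flows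
    (ΦF Φv : ℝ → ℝ → X → X)
    (hΦF : IsFlow X I S.nominal ΦF) (hΦv : IsFlow X I (S.probFlow X w ρ) Φv)
    -- contraction condition with metric bounds
    (M Θ : Euc n → ℝ → Matrix (Fin n) (Fin n) ℝ) (α mlo mhi : ℝ) (hmlo : 0 < mlo) (hmhi : 0 < mhi)
    (hM : IsContractionMetric X I S.nominal M Θ α mlo mhi)
    -- bounded perturbation
    (dbar : ℝ) (hd : ∀ x ∈ X, ∀ t ∈ I, ‖S.perturbation X w ρ x t‖ ≤ dbar)
    -- initial laws
    (μ₀ ν₀ : Measure X) (hμ₀ : IsP2 μ₀) (hν₀ : IsP2 ν₀)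
    (t : ℝ) (ht : t ∈ I) :
    IsP2 (pfOperator ΦF 0 t μ₀) ∧ IsP2 (pfOperator Φv 0 t ν₀) ∧
    W2 (pfOperator ΦF 0 t μ₀) (pfOperator Φv 0 t ν₀) ≤
      ENNReal.ofReal (Real.sqrt (mhi / mlo) * Real.exp (α * t)) * W2 μ₀ ν₀ +
      ENNReal.ofReal
        (Real.sqrt (mhi / mlo) * dbar * ∫ r in (0 : ℝ)..t, Real.exp (α * (t - r))) := by
  have ht0 : 0 ≤ t := hIpos ht
  set κ := Real.sqrt (mhi / mlo) with hκ
  have hκ0 : 0 < κ := Real.sqrt_pos.2 (div_pos hmhi hmlo)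
  obtain ⟨x₀, hx₀⟩ := hXint.mono interior_subset
  have hdbar : 0 ≤ dbar := (norm_nonneg _).trans (hd x₀ hx₀ 0 hI0)
  have hexp : ∀ s ∈ I, ∀ t ∈ I, s ≤ t → ∀ a b : X,
      ‖(ΦF s t b : Euc n) - ΦF s t a‖ ≤ κ * Real.exp (α * (t - s)) * ‖(b : Euc n) - a‖ :=
    fun s hs t ht hst a b =>
      hM.norm_flow_sub_le hXconv hXint hmlo hmhi hI hFdiff hFjac hΦF hs ht hst a b
  set E := κ * Real.exp (α * t) with hE
  set R := κ * dbar * ∫ r in (0 : ℝ)..t, Real.exp (α * (t - r)) with hR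
  have hR0 : 0 ≤ R := mul_nonneg (mul_nonneg hκ0.le hdbar)
    (intervalIntegral.integral_nonneg ht0 fun _ _ => (Real.exp_pos _).le)
  have hE0 : 0 < E := mul_pos hκ0 (Real.exp_pos _)
  have hnom : ∀ a b : X, ‖(ΦF 0 t a : Euc n) - ΦF 0 t b‖ ≤ E * ‖(a : Euc n) - b‖ := fun a b => by
    simpa using hexp 0 hI0 t ht ht0 b a
  have hpert : ∀ y : X, ‖(Φv 0 t y : Euc n) - ΦF 0 t y‖ ≤ R := fun y =>
    hΦF.norm_perturbed_sub_le hΦv hI hFcont hκ0.le hexp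
      (fun x hx r hr => by simpa [S.probFlow_eq] using hd x hx r hr) hI0 ht ht0 y
  -- Comparison with the trajectory of one reference point x₀ turns the Lipschitz bound into affine
  -- growth, which preserves second moments.
  have hgrowth : ∀ x : X, ‖(ΦF 0 t x : Euc n)‖
      ≤ E * ‖(x : Euc n)‖ + (E * ‖x₀‖ + ‖(ΦF 0 t ⟨x₀, hx₀⟩ : Euc n)‖) := fun x => by
    have h1 := hnom x ⟨x₀, hx₀⟩
    have h2 := norm_le_norm_add_norm_sub' (ΦF 0 t x : Euc n) (ΦF 0 t ⟨x₀, hx₀⟩)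
    have h3 := mul_le_mul_of_nonneg_left (norm_sub_le (x : Euc n) x₀) hE0.le
    simp only at h1
    linarith
  have hmF := hΦF.meas 0 hI0 t ht ht0
  have hmv := hΦv.meas 0 hI0 t ht ht0
  refine ⟨hμ₀.map hmF hgrowth, hν₀.map hmv
    (b := E * ‖x₀‖ + ‖(ΦF 0 t ⟨x₀, hx₀⟩ : Euc n)‖ + R) (a := E) fun y => ?_, ?_⟩
  · have h1 := hgrowth y
    have h2 := norm_le_norm_add_norm_sub' (Φv 0 t y : Euc n) (ΦF 0 t y)
    have h3 := hpert y
    linarith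
  · have := hμ₀.1
    refine W2_map_le hmF hmv (ENNReal.ofReal_pos.2 hE0).ne' ENNReal.ofReal_ne_top fun x y => ?_
    rw [edist_dist, edist_dist, ← ENNReal.ofReal_mul hE0.le,
      ← ENNReal.ofReal_add (by positivity) hR0]
    refine ENNReal.ofReal_le_ofReal ?_
    rw [Subtype.dist_eq, Subtype.dist_eq, dist_eq_norm, dist_eq_norm]
    have h1 := norm_sub_le_norm_sub_add_norm_sub (ΦF 0 t x : Euc n) (ΦF 0 t y) (Φv 0 t y)
    have h2 := hpert y
    rw [norm_sub_rev] at h2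
    linarith [hnom x y]
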